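/- Fix a field $k$. All posets are finite, a sheaf on a poset $\Pi$ is a functor $F$ from $\Pi$ to finite-dimensional $k$-vector spaces (spaces $F(\pi)$ and compatible linear maps $F(\pi\le\tau):F(\pi)\to F(\tau)$ for $\pi\le\tau$), and all complexes of sheaves are bounded. For $\pi\in\Pi$ let $[\pi]$ be the sheaf with $[\pi](\sigma)=k$ for $\sigma\le\pi$ and $0$ otherwise, with identity maps between the elements $\le\pi$; every injective sheaf is a finite direct sum of such sheaves. A complex $I^\bullet$ of injective sheaves is minimal if, for every complex $J^\bullet$ of injective sheaves quasi-isomorphic to $I^\bullet$ and every $d$, the number of summands $[\pi]$ in $I^d$ is at most the number of those in $J^d$. For an additive functor $F$ between categories of sheaves and a complex of injective sheaves $I^\bullet$, $RF I^\bullet$ denotes the minimal injective resolution of the complex $F(I^\bullet)$, i.e. a minimal complex of injective sheaves $J^\bullet$ with a quasi-isomorphism $F(I^\bullet)\to J^\bullet$; it is determined up to isomorphism of complexes. For an order preserving map $f:\Pi\to\Lambda$ put $f^*F(\pi)=F(f(\pi))$. For the inclusion $i:Z\hookrightarrow\Pi$ of a locally closed subset (the intersection of an upper set and a lower set), $i_!F$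 is the extension of $F$ by zero, and \[ i^!F(\zeta)=\{v\in F(\zeta): F(\zeta\le\tau)(v)=0\text{ for all }\tau\ge\zeta\text{ with }\tau\in\Pi\setminus Z\}. \] The mapping cylinder $\Pi\sqcup_f\Lambda$ is the disjoint union of $\Pi$ and $\Lambda$, ordered by the given orders on $\Pi$ and $\Lambda$ together with $\pi\le\lambda$ if and only if $f(\pi)\le\lambda$, for $\pi\in\Pi$, $\lambda\in\Lambda$ (and never $\lambda\le\pi$). Proposition. Let $f:\Pi\to\Lambda$ be an order preserving map of finite posets, let $p:\Pi\hookrightarrow\Pi\sqcup_f\Lambda$ and $\ell:\Lambda\hookrightarrow\Pi\sqcup_f\Lambda$ be the inclusions into the mapping cylinder, and let $I^\bullet$ be a complex of injective sheaves on $\Lambda$. Then $Rf^*I^\bullet$, $R\ell_!I^\bullet$ and $Rp^!R\ell_!I^\bullet$ exist, and \[ Rf^*I^\bullet\cong\bigl(Rp^!R\ell_!I^\bullet\bigr)^{\bullet+1} \] as complexes of sheaves on $\Pi$, where $J^{\bullet+1}$ denotes the complex with $(J^{\bullet+1})^d=J^{d+1}$ and differential $-\delta^{d+1}$ if $\delta$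 is the differential of $J^\bullet$ (keeping the sign of $\delta$ gives an isomorphic complex). -/

import Mathlib

open CategoryTheory CategoryTheory.Limits

universe u v w

noncomputable section

namespace PosetSheaf

/-- A sheaf of finite-dimensional `k`-vector spaces on a poset `P` (with the Alexandrov topology,
whose open sets are the upper sets): a vector space `F(σ)` for every `σ` and a linear map
`F(σ ≤ τ) : F(σ) → F(τ)` for every `σ ≤ τ`, functorially. Morphisms are natural transformations. -/
abbrev Sheaf (k : Type u) [Field k] (P : Type v) [PartialOrder P] :=
  P ⥤ FGModuleCat.{u} k

section Mapping_cylinder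

/-- The underlying set of the mapping cylinder of `f : P → L`: the disjoint union of `P` and `L`. -/
inductive MappingCylinder {P : Type v} {L : Type w} [PartialOrder P] [PartialOrder L]
    (f : P →o L) : Type (max v w)
  | inl (p : P) : MappingCylinder f
  | inr (l : L) : MappingCylinder f

variable {P : Type v} {L : Type w} [PartialOrder P] [PartialOrder L]

namespace MappingCylinder

/-- The order relation of the mapping cylinder. -/
def le (f : P →o L) : MappingCylinder f → MappingCylinder f → Prop
  | inl p, inl q => p ≤ q
  | inr l, inr m => l ≤ m
  | inl p, inr l => f p ≤ l
  | inr _, inl _ => False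

instance (f : P →o L) : PartialOrder (MappingCylinder f) where
  le := le f
  le_refl x := by cases x <;> exact le_refl _
  le_trans x y z hxy hyz := by
    rcases x with x | x <;> rcases y with y | y <;> rcases z with z | z
    · exact le_trans (α := P) hxy hyz
    · exact le_trans (α := L) (f.monotone hxy) hyz
    · exact hyz.elim
    · exact le_trans (α := L) hxy hyz
    · exact hxy.elim
    · exact hxy.elim
    · exact hyz.elim
    · exact le_trans (α := L) hxy hyz
  le_antisymm x y hxy hyx := by
    rcases x with x | x <;> rcases y with y | y
    · exact congrArg inl (le_antisymm (α := P) hxy hyx)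
    · exact hyx.elim
    · exact hxy.elim
    · exact congrArg inr (le_antisymm (α := L) hxy hyx)

/-- The inclusion of the source `P` into the mapping cylinder. -/
def inclSource (f : P →o L) : P ↪o MappingCylinder f where
  toFun := inl
  inj' _ _ h := by cases h; rfl
  map_rel_iff' := Iff.rfl

/-- The inclusion of the target `L` into the mapping cylinder. -/
def inclTarget (f : P →o L) : L ↪o MappingCylinder f where
  toFun := inr
  inj' _ _ h := by cases h; rfl
  map_rel_iff' := Iff.rfl

end MappingCylinder

end Mapping_cylinder

/-- A subset of a poset is locally closed (for the Alexandrov topology) if it is the intersection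
of an open set (an upper set) and a closed set (a lower set). -/
def IsLocallyClosed {P : Type v} [PartialOrder P] (Z : Set P) : Prop :=
  ∃ U C : Set P, IsUpperSet U ∧ IsLowerSet C ∧ Z = U ∩ C

theorem MappingCylinder.isLocallyClosed_source {P : Type v} {L : Type w} [PartialOrder P]
    [PartialOrder L] (f : P →o L) : IsLocallyClosed (Set.range (inclSource f)) := by
  refine ⟨Set.univ, Set.range (inclSource f), isUpperSet_univ, ?_, by simp⟩
  rintro x y hyx ⟨p, rfl⟩
  rcases y with q | l
  · exact ⟨q, rfl⟩
  · exact hyx.elim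

theorem MappingCylinder.isLocallyClosed_target {P : Type v} {L : Type w} [PartialOrder P]
    [PartialOrder L] (f : P →o L) : IsLocallyClosed (Set.range (inclTarget f)) := by
  refine ⟨Set.range (inclTarget f), Set.univ, ?_, isLowerSet_univ, by simp⟩
  rintro x y hxy ⟨l, rfl⟩
  rcases y with q | m
  · exact hxy.elim
  · exact ⟨m, rfl⟩

section Functors

variable (k : Type u) [Field k]
variable {P : Type v} {Q : Type w} [PartialOrder P] [PartialOrder Q]

/-- The pullback `f^*`: `(f^* F)(σ) = F(f(σ))`. -/
def pullback (f : P →o Q) : Sheaf k Q ⥤ Sheaf k P :=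
  (Functor.whiskeringLeft P Q (FGModuleCat.{u} k)).obj f.monotone.functor

instance (f : P →o Q) : (pullback k f).Additive where
  map_add := rfl

/-- The element of `P` lying over an element of the image of an embedding `e : P → Q`. -/
def preimage {e : P ↪o Q} {σ : Q} (h : σ ∈ Set.range e) : P := h.choose

theorem apply_preimage {e : P ↪o Q} {σ : Q} (h : σ ∈ Set.range e) : e (preimage h) = σ :=
  h.choose_spec

theorem preimage_le {e : P ↪o Q} {σ τ : Q} (hσ : σ ∈ Set.range e) (hτ : τ ∈ Set.range e)
    (h : σ ≤ τ) : preimage hσ ≤ preimage hτ := by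
  rwa [← e.le_iff_le, apply_preimage, apply_preimage]

variable {k}

/-- The vector space of the proper pushforward at `σ`: it is `F(z)` if `σ = e(z)`, and `0` if `σ` is
not in the image of `e` (functions on the set of proofs of `σ ∈ range e`, which has one element
or none). -/
abbrev ExtByZero (e : P ↪o Q) (F : Sheaf k P) (σ : Q) : Type u :=
  ∀ h : PLift (σ ∈ Set.range e), F.obj (preimage h.down)

open Classical in
/-- The structure maps of the proper pushforward: those of `F` between elements of the image of `e`,
and `0` otherwise. -/
def extByZeroMap (e : P ↪o Q) (F : Sheaf k P) {σ τ : Q} (hστ : σ ≤ τ) :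
    ExtByZero e F σ →ₗ[k] ExtByZero e F τ :=
  LinearMap.pi fun hτ =>
    if hσ : σ ∈ Set.range e then
      (F.map (homOfLE (preimage_le hσ hτ.down hστ))).hom.hom ∘ₗ LinearMap.proj (PLift.up hσ)
    else 0

theorem extByZeroMap_apply_of_mem (e : P ↪o Q) (F : Sheaf k P) {σ τ : Q} (hστ : σ ≤ τ)
    (hσ : σ ∈ Set.range e) (x : ExtByZero e F σ) (hτ : PLift (τ ∈ Set.range e)) :
    extByZeroMap e F hστ x hτ =
      (F.map (homOfLE (preimage_le hσ hτ.down hστ))).hom.hom (x ⟨hσ⟩) := by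
  simp [extByZeroMap, hσ]

theorem extByZeroMap_apply_of_notMem (e : P ↪o Q) (F : Sheaf k P) {σ τ : Q} (hστ : σ ≤ τ)
    (hσ : σ ∉ Set.range e) (x : ExtByZero e F σ) (hτ : PLift (τ ∈ Set.range e)) :
    extByZeroMap e F hστ x hτ = 0 := by
  unfold extByZeroMap
  rw [LinearMap.pi_apply, dif_neg hσ]
  rfl

theorem extByZeroMap_refl (e : P ↪o Q) (F : Sheaf k P) (σ : Q) (x : ExtByZero e F σ) :
    extByZeroMap e F (le_refl σ) x = x := by
  funext hσ
  rw [extByZeroMap_apply_of_mem e F (le_refl σ) hσ.down]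
  exact congrArg (fun g => g.hom.hom (x hσ)) (F.map_id (preimage hσ.down))

theorem extByZeroMap_trans (e : P ↪o Q) (he : IsLocallyClosed (Set.range e)) (F : Sheaf k P)
    {σ τ ρ : Q} (a : σ ≤ τ) (b : τ ≤ ρ) (x : ExtByZero e F σ) :
    extByZeroMap e F (a.trans b) x = extByZeroMap e F b (extByZeroMap e F a x) := by
  funext hρ
  by_cases hσ : σ ∈ Set.range e
  · have hτ : τ ∈ Set.range e := by
      have hρ' := hρ.down
      obtain ⟨U, C, hU, hC, hZ⟩ := he
      rw [hZ] at hσ hρ' ⊢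
      exact ⟨hU a hσ.1, hC b hρ'.2⟩
    rw [extByZeroMap_apply_of_mem e F _ hσ, extByZeroMap_apply_of_mem e F _ hτ,
      extByZeroMap_apply_of_mem e F _ hσ]
    exact congrArg (fun g => g.hom.hom (x ⟨hσ⟩))
      (F.map_comp (homOfLE (preimage_le hσ hτ a)) (homOfLE (preimage_le hτ hρ.down b)))
  · rw [extByZeroMap_apply_of_notMem e F _ hσ]
    by_cases hτ : τ ∈ Set.range e
    · rw [extByZeroMap_apply_of_mem e F _ hτ, extByZeroMap_apply_of_notMem e F _ hσ, map_zero]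
    · rw [extByZeroMap_apply_of_notMem e F _ hτ]

/-- The linear map at `σ` induced by a morphism of sheaves on the proper pushforwards. -/
def extByZeroApp (e : P ↪o Q) {F G : Sheaf k P} (η : F ⟶ G) (σ : Q) :
    ExtByZero e F σ →ₗ[k] ExtByZero e G σ :=
  LinearMap.pi fun h => (η.app (preimage h.down)).hom.hom ∘ₗ LinearMap.proj h

theorem extByZeroApp_naturality (e : P ↪o Q) {F G : Sheaf k P} (η : F ⟶ G) {σ τ : Q} (a : σ ≤ τ)
    (x : ExtByZero e F σ) :
    extByZeroApp e η τ (extByZeroMap e F a x) = extByZeroMap e G a (extByZeroApp e η σ x) := by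
  funext hτ
  change (η.app (preimage hτ.down)).hom.hom (extByZeroMap e F a x hτ) = _
  by_cases hσ : σ ∈ Set.range e
  · rw [extByZeroMap_apply_of_mem e F _ hσ, extByZeroMap_apply_of_mem e G _ hσ]
    exact congrArg (fun g => g.hom.hom (x ⟨hσ⟩))
      (η.naturality (homOfLE (preimage_le hσ hτ.down a)))
  · rw [extByZeroMap_apply_of_notMem e F _ hσ, extByZeroMap_apply_of_notMem e G _ hσ, map_zero]

variable (k) in
/-- The proper pushforward functor `e_!` along an inclusion `e` with locally closed image. -/
def properPushforward (e : P ↪o Q) (he : IsLocallyClosed (Set.range e)) :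
    Sheaf k P ⥤ Sheaf k Q where
  obj F :=
    { obj := fun σ => FGModuleCat.of k (ExtByZero e F σ)
      map := fun {_ _} a => FGModuleCat.ofHom (extByZeroMap e F (leOfHom a))
      map_id := fun σ => FGModuleCat.hom_ext (LinearMap.ext (extByZeroMap_refl e F σ))
      map_comp := fun {_ _ _} a b => FGModuleCat.hom_ext
        (LinearMap.ext (extByZeroMap_trans e he F (leOfHom a) (leOfHom b))) }
  map η :=
    { app := fun σ => FGModuleCat.ofHom (extByZeroApp e η σ)
      naturality := fun {_ _} a => FGModuleCat.hom_ext
        (LinearMap.ext (extByZeroApp_naturality e η (leOfHom a))) }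

instance (e : P ↪o Q) (he : IsLocallyClosed (Set.range e)) :
    (properPushforward k e he).Additive where
  map_add := rfl

/-- The vector space of the proper pullback at `ζ`: the vectors of `F(e(ζ))` which are sent to `0` by
`F(e(ζ) ≤ τ)` for every `τ ≥ e(ζ)` outside the image of `e`. -/
def properSections (e : P ↪o Q) (F : Sheaf k Q) (ζ : P) : Submodule k (F.obj (e ζ)) where
  carrier := {x | ∀ (τ : Q) (h : e ζ ≤ τ), τ ∉ Set.range e → (F.map (homOfLE h)).hom.hom x = 0}
  add_mem' hx hy τ h hτ := by rw [map_add, hx τ h hτ, hy τ h hτ, add_zero]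
  zero_mem' τ h _ := map_zero _
  smul_mem' c x hx τ h hτ := by rw [map_smul, hx τ h hτ, smul_zero]

theorem map_mem_properSections (e : P ↪o Q) (F : Sheaf k Q) {ζ ξ : P} (h : ζ ≤ ξ)
    (x : F.obj (e ζ)) (hx : x ∈ properSections e F ζ) :
    (F.map (homOfLE (e.monotone h))).hom.hom x ∈ properSections e F ξ := by
  intro τ hτ hmem
  have := congrArg (fun g => g.hom.hom x) (F.map_comp (homOfLE (e.monotone h)) (homOfLE hτ))
  exact this.symm.trans (hx τ ((e.monotone h).trans hτ) hmem)

theorem app_mem_properSections (e : P ↪o Q) {F G : Sheaf k Q} (η : F ⟶ G) (ζ : P)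
    (x : F.obj (e ζ)) (hx : x ∈ properSections e F ζ) :
    (η.app (e ζ)).hom.hom x ∈ properSections e G ζ := by
  intro τ hτ hmem
  have := congrArg (fun g => g.hom.hom x) (η.naturality (homOfLE hτ))
  refine this.symm.trans ?_
  change (η.app τ).hom.hom ((F.map (homOfLE hτ)).hom.hom x) = 0
  rw [hx τ hτ hmem, map_zero]

variable (k) in
/-- The proper pullback functor `e^!` (used for inclusions `e` with locally closed image). -/
def properPullback (e : P ↪o Q) : Sheaf k Q ⥤ Sheaf k P where
  obj F :=
    { obj := fun ζ => FGModuleCat.of k (properSections e F ζ)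
      map := fun {ζ ξ} h => FGModuleCat.ofHom
        ((F.map (homOfLE (e.monotone (leOfHom h)))).hom.hom.restrict
          (map_mem_properSections e F (leOfHom h)))
      map_id := by
        intro ζ
        apply FGModuleCat.hom_ext
        refine LinearMap.ext fun x => Subtype.ext ?_
        exact congrArg (fun g => g.hom.hom x.1) (F.map_id (e ζ))
      map_comp := by
        intro ζ ξ ρ a b
        apply FGModuleCat.hom_ext
        refine LinearMap.ext fun x => Subtype.ext ?_
        exact congrArg (fun g => g.hom.hom x.1)
          (F.map_comp (homOfLE (e.monotone (leOfHom a))) (homOfLE (e.monotone (leOfHom b)))) }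
  map {F G} η :=
    { app := fun ζ => FGModuleCat.ofHom
        ((η.app (e ζ)).hom.hom.restrict (app_mem_properSections e η ζ))
      naturality := by
        intro ζ ξ a
        apply FGModuleCat.hom_ext
        refine LinearMap.ext fun x => Subtype.ext ?_
        exact congrArg (fun g => g.hom.hom x.1) (η.naturality (homOfLE (e.monotone (leOfHom a)))) }

instance (e : P ↪o Q) : (properPullback k e).Additive where
  map_add := rfl

end Functors

section Complexes

variable {k : Type u} [Field k] {P : Type v} [PartialOrder P] {Q : Type w} [PartialOrder Q]

variable (k) in
/-- The indecomposable injective sheaf `[π]`: it is `k` at every `σ ≤ π` and `0` elsewhere (functions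
to `k` on the set of proofs of `σ ≤ π`), with identity maps between the elements below `π`. -/
def indecInjective (π : P) : Sheaf k P where
  obj σ := FGModuleCat.of k (PLift (σ ≤ π) → k)
  map {_ _} h := FGModuleCat.ofHom
    (LinearMap.funLeft k k fun hτ => PLift.up ((leOfHom h).trans hτ.down))

attribute [local instance] Abelian.hasFiniteBiproducts

/-- `I` is a direct sum of `n` indecomposable injective sheaves. -/
def HasSummandCount (I : Sheaf k P) (n : ℕ) : Prop :=
  ∃ π : Fin n → P, Nonempty (I ≅ ⨁ fun j => indecInjective k (π j))

/-- A bounded complex of injective sheaves. -/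
structure IsInjectiveComplex (I : CochainComplex (Sheaf k P) ℤ) : Prop where
  bounded : ∃ N : ℕ, ∀ d : ℤ, (N : ℤ) < |d| → IsZero (I.X d)
  injective : ∀ d : ℤ, Injective (I.X d)

/-- Two complexes are quasi-isomorphic if they are joined by a roof of quasi-isomorphisms. -/
def QuasiIsomorphic (A B : CochainComplex (Sheaf k P) ℤ) : Prop :=
  ∃ (K : CochainComplex (Sheaf k P) ℤ) (α : K ⟶ A) (β : K ⟶ B), QuasiIso α ∧ QuasiIso β

/-- A bounded complex of injective sheaves is minimal if in every degree it has at most as many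
indecomposable summands as any quasi-isomorphic bounded complex of injective sheaves. -/
structure IsMinimalInjectiveComplex (I : CochainComplex (Sheaf k P) ℤ) : Prop
    extends IsInjectiveComplex I where
  minimal : ∀ J : CochainComplex (Sheaf k P) ℤ, IsInjectiveComplex J → QuasiIsomorphic I J →
    ∀ (d : ℤ) (n m : ℕ), HasSummandCount (I.X d) n → HasSummandCount (J.X d) m → n ≤ m

/-- `J` is a minimal injective resolution of the complex `A`. -/
def IsMinimalInjectiveResolution (A J : CochainComplex (Sheaf k P) ℤ) : Prop :=
  IsMinimalInjectiveComplex J ∧ ∃ α : A ⟶ J, QuasiIso α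

/-- `J` is (a representative of) `RF(I)`: a minimal injective resolution of the complex
`⋯ → F(I^d) → F(I^{d+1}) → ⋯`. -/
def IsRightDerived (F : Sheaf k P ⥤ Sheaf k Q) [F.Additive]
    (I : CochainComplex (Sheaf k P) ℤ) (J : CochainComplex (Sheaf k Q) ℤ) : Prop :=
  IsMinimalInjectiveResolution ((F.mapHomologicalComplex (ComplexShape.up ℤ)).obj I) J

end Complexes

end PosetSheaf

end

-- For an injective sheaf `F` on the cylinder there is a short exact sequence `0 → p^! F → p^* F →
-- f^* ℓ^* F → 0`: a section over the source is proper iff it dies at `f π`, the least target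
-- element above `π`, and structure maps of injective sheaves are surjective (`res_surjective`).
-- Apply it degreewise to `B = Rℓ_! I`. Since `p^*` is exact and `p^* ℓ_! = 0`, the middle term is
-- acyclic; since `ℓ^*` and `f^*` are exact and `ℓ^* ℓ_! = id`, the right term is `f^* I` up to
-- quasi-isomorphism. The connecting map gives `f^* I ≅ (p^! B)[1]` in the derived category.
--
-- To get an isomorphism of complexes, minimality is compared with being radical: the differential
-- kills all socles. Every bounded injective complex is homotopy equivalent to a radical one
-- (`exists_radical`), and a radical complex is minimal and isomorphic to every minimal complex with
-- the same image in the derived category (`IsRadical.nonempty_iso`). Socle dimensions count the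
-- summands `[π]`. Resolutions exist because embedding into the Godement sheaf shrinks the support.

universe w₁

noncomputable section

namespace PosetSheaf

/-! ### Sheaves and their morphisms through stalks -/

section Pointwise

variable {k : Type u} [Field k] {P : Type v} [PartialOrder P]

/-- The structure map `F(σ ≤ τ)` of a sheaf, as a linear map. -/
def res (F : Sheaf k P) {σ τ : P} (h : σ ≤ τ) : F.obj σ →ₗ[k] F.obj τ :=
  (F.map (homOfLE h)).hom.hom

/-- The component at `σ` of a morphism of sheaves, as a linear map. -/
def comp {F G : Sheaf k P} (η : F ⟶ G) (σ : P) : F.obj σ →ₗ[k] G.obj σ :=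
  (η.app σ).hom.hom

theorem res_refl (F : Sheaf k P) (σ : P) (x : F.obj σ) : res F (le_refl σ) x = x :=
  congrArg (fun g => g.hom.hom x) (F.map_id σ)

theorem res_res (F : Sheaf k P) {σ τ ρ : P} (h : σ ≤ τ) (h' : τ ≤ ρ) (x : F.obj σ) :
    res F h' (res F h x) = res F (h.trans h') x :=
  (congrArg (fun g => g.hom.hom x) (F.map_comp (homOfLE h) (homOfLE h'))).symm

theorem comp_res {F G : Sheaf k P} (η : F ⟶ G) {σ τ : P} (h : σ ≤ τ) (x : F.obj σ) :
    comp η τ (res F h x) = res G h (comp η σ x) :=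
  congrArg (fun g => g.hom.hom x) (η.naturality (homOfLE h))

@[simp]
theorem comp_id_apply (F : Sheaf k P) (σ : P) (x : F.obj σ) : comp (𝟙 F) σ x = x := rfl

@[simp]
theorem comp_comp_apply {F G H : Sheaf k P} (η : F ⟶ G) (θ : G ⟶ H) (σ : P) (x : F.obj σ) :
    comp (η ≫ θ) σ x = comp θ σ (comp η σ x) := rfl

@[simp]
theorem comp_add_apply {F G : Sheaf k P} (η θ : F ⟶ G) (σ : P) (x : F.obj σ) :
    comp (η + θ) σ x = comp η σ x + comp θ σ x := rfl

@[simp]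
theorem comp_zero_apply {F G : Sheaf k P} (σ : P) (x : F.obj σ) :
    comp (0 : F ⟶ G) σ x = 0 := rfl

theorem comp_sum_apply {F G : Sheaf k P} {ι : Type*} (s : Finset ι) (η : ι → (F ⟶ G)) (σ : P)
    (x : F.obj σ) : comp (∑ i ∈ s, η i) σ x = ∑ i ∈ s, comp (η i) σ x := by
  classical
  induction s using Finset.induction_on with
  | empty => simp
  | insert a s ha ih => rw [Finset.sum_insert ha, Finset.sum_insert ha, comp_add_apply, ih]

theorem hom_ext_comp {F G : Sheaf k P} {η θ : F ⟶ G} (h : ∀ σ x, comp η σ x = comp θ σ x) :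
    η = θ := by
  ext σ : 2
  exact FGModuleCat.hom_ext (LinearMap.ext (h σ))

/-- A natural family of linear maps is a morphism of sheaves. -/
def mkHom {F G : Sheaf k P} (φ : ∀ σ, F.obj σ →ₗ[k] G.obj σ)
    (hφ : ∀ (σ τ : P) (h : σ ≤ τ) (x : F.obj σ), φ τ (res F h x) = res G h (φ σ x)) : F ⟶ G where
  app σ := FGModuleCat.ofHom (φ σ)
  naturality σ τ h := FGModuleCat.hom_ext (LinearMap.ext fun x => hφ σ τ (leOfHom h) x)

theorem mono_iff_injective {F G : Sheaf k P} (η : F ⟶ G) :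
    Mono η ↔ ∀ σ, Function.Injective (comp η σ) := by
  rw [NatTrans.mono_iff_mono_app]
  refine forall_congr' fun σ => ?_
  rw [← (forget₂ (FGModuleCat.{u} k) (ModuleCat.{u} k)).mono_map_iff_mono,
    ModuleCat.mono_iff_injective]
  rfl

theorem epi_iff_surjective {F G : Sheaf k P} (η : F ⟶ G) :
    Epi η ↔ ∀ σ, Function.Surjective (comp η σ) := by
  rw [NatTrans.epi_iff_epi_app]
  refine forall_congr' fun σ => ?_
  rw [← (forget₂ (FGModuleCat.{u} k) (ModuleCat.{u} k)).epi_map_iff_epi,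
    ModuleCat.epi_iff_surjective]
  rfl

theorem isZero_iff_subsingleton (F : Sheaf k P) : IsZero F ↔ ∀ σ, Subsingleton (F.obj σ) := by
  rw [IsZero.iff_id_eq_zero]
  constructor
  · refine fun h σ => subsingleton_of_forall_eq 0 fun x => ?_
    rw [← comp_id_apply F σ x, h, comp_zero_apply]
  · exact fun h => hom_ext_comp fun σ x => (h σ).elim _ _

/-- Stalks are finite-dimensional, so injections both ways force equal dimensions; `θ` need not be
inverse to `η`. -/
theorem isIso_of_mono_of_mono {F G : Sheaf k P} (η : F ⟶ G) (θ : G ⟶ F) [Mono η] [Mono θ] :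
    IsIso η := by
  have hη := (mono_iff_injective η).1 inferInstance
  have hθ := (mono_iff_injective θ).1 inferInstance
  have : Epi η := (epi_iff_surjective η).2 fun σ =>
    (LinearMap.injective_iff_surjective_of_finrank_eq_finrank
      (le_antisymm (LinearMap.finrank_le_finrank_of_injective (hη σ))
        (LinearMap.finrank_le_finrank_of_injective (hθ σ)))).1 (hη σ)
  exact isIso_of_mono_of_epi η

end Pointwise

/-! ### Socles -/

section Socle

variable {k : Type u} [Field k] {P : Type v} [PartialOrder P]

/-- The multiplicity space at `σ` of the socle of a sheaf: the vectors at `σ` which are sent to `0`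
in all larger elements. -/
def socle (F : Sheaf k P) (σ : P) : Submodule k (F.obj σ) where
  carrier := {x | ∀ (τ : P) (h : σ < τ), res F h.le x = 0}
  add_mem' hx hy τ h := by rw [map_add, hx τ h, hy τ h, add_zero]
  zero_mem' τ h := map_zero _
  smul_mem' c x hx τ h := by rw [map_smul, hx τ h, smul_zero]

theorem comp_mem_socle {F G : Sheaf k P} (η : F ⟶ G) {σ : P} {x : F.obj σ} (hx : x ∈ socle F σ) :
    comp η σ x ∈ socle G σ := fun τ h => by rw [← comp_res, hx τ h, map_zero]

/-- The map induced on socles by a morphism of sheaves. -/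
def socleMap {F G : Sheaf k P} (η : F ⟶ G) (σ : P) : socle F σ →ₗ[k] socle G σ :=
  (comp η σ).restrict fun _ hx => comp_mem_socle η hx

@[simp]
theorem socleMap_coe {F G : Sheaf k P} (η : F ⟶ G) (σ : P) (x : socle F σ) :
    (socleMap η σ x : G.obj σ) = comp η σ x := rfl

/-- Downward induction on the poset: once `η` is injective above `σ`, a kernel vector at `σ`
restricts to zero there, so it lies in the socle. -/
theorem mono_of_socle [Finite P] {F G : Sheaf k P} (η : F ⟶ G)
    (h : ∀ σ, ∀ x ∈ socle F σ, comp η σ x = 0 → x = 0) : Mono η := by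
  rw [mono_iff_injective]
  intro σ
  rw [injective_iff_map_eq_zero]
  induction σ using WellFoundedGT.induction with
  | ind σ ih =>
    refine fun x hx => h σ x (fun τ hτ => ih τ hτ _ ?_) hx
    rw [comp_res, hx, map_zero]

theorem mono_iff_socle_injective [Finite P] {F G : Sheaf k P} (η : F ⟶ G) :
    Mono η ↔ ∀ σ, Function.Injective (socleMap η σ) := by
  constructor
  · intro hη σ x y hxy
    exact Subtype.ext ((mono_iff_injective η).1 hη σ (congrArg Subtype.val hxy))
  · refine fun h => mono_of_socle η fun σ x hx h0 => ?_
    have : (⟨x, hx⟩ : socle F σ) = 0 := h σ (Subtype.ext (by simpa using h0))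
    exact congrArg Subtype.val this

/-- The total dimension of the socle. -/
def socleRank [Finite P] (F : Sheaf k P) : ℕ :=
  letI := Fintype.ofFinite P
  ∑ σ, Module.finrank k (socle F σ)

theorem socleRank_le_of_mono [Finite P] {F G : Sheaf k P} (η : F ⟶ G) [Mono η] :
    socleRank F ≤ socleRank G :=
  Finset.sum_le_sum fun σ _ => LinearMap.finrank_le_finrank_of_injective
    ((mono_iff_socle_injective η).1 inferInstance σ)

theorem socleMap_surjective_of_socleRank_le [Finite P] {F G : Sheaf k P} (η : F ⟶ G) [Mono η]
    (h : socleRank G ≤ socleRank F) (σ : P) : Function.Surjective (socleMap η σ) := by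
  let := Fintype.ofFinite P
  have hη := (mono_iff_socle_injective η).1 inferInstance
  have key := (Finset.sum_eq_sum_iff_of_le fun σ (_ : σ ∈ Finset.univ) =>
    LinearMap.finrank_le_finrank_of_injective (hη σ)).1
      (le_antisymm (socleRank_le_of_mono η) h) σ (Finset.mem_univ σ)
  exact (LinearMap.injective_iff_surjective_of_finrank_eq_finrank key).1 (hη σ)

/-- If a monomorphism with a retraction does not increase the total dimension of the socle, it is
an isomorphism. -/
theorem isIso_of_retraction [Finite P] {F G : Sheaf k P} (η : F ⟶ G) (θ : G ⟶ F)
    (hηθ : ∀ σ, ∀ x ∈ socle F σ, comp θ σ (comp η σ x) = x) (h : socleRank G ≤ socleRank F) :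
    IsIso η := by
  have : Mono η := mono_of_socle η fun σ x hx h0 => by rw [← hηθ σ x hx, h0, map_zero]
  -- Socle vectors of `G` all come from `F` by the rank bound, and there `θ` inverts `η`.
  have : Mono θ := by
    refine mono_of_socle θ fun σ y hy h0 => ?_
    obtain ⟨x, hx⟩ := socleMap_surjective_of_socleRank_le η h σ ⟨y, hy⟩
    obtain rfl : comp η σ x = y := congrArg Subtype.val hx
    rw [hηθ σ x x.2] at h0
    rw [h0, map_zero]
  exact isIso_of_mono_of_mono η θ

theorem socleRank_eq_of_iso [Finite P] {F G : Sheaf k P} (e : F ≅ G) :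
    socleRank F = socleRank G :=
  le_antisymm (socleRank_le_of_mono e.hom) (socleRank_le_of_mono e.inv)

end Socle

/-! ### The injective sheaves `[π]` and injective hulls -/

section Indecomposable

variable {k : Type u} [Field k] {P : Type v} [PartialOrder P]

attribute [local instance] Abelian.hasFiniteBiproducts

theorem exists_extend_of_injective {V W U : Type*} [AddCommGroup V] [Module k V] [AddCommGroup W]
    [Module k W] [AddCommGroup U] [Module k U] (i : V →ₗ[k] W) (hi : Function.Injective i)
    (φ : V →ₗ[k] U) : ∃ ψ : W →ₗ[k] U, ∀ x, ψ (i x) = φ x := by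
  obtain ⟨r, hr⟩ := LinearMap.exists_leftInverse_of_injective i (LinearMap.ker_eq_bot.2 hi)
  exact ⟨φ ∘ₗ r, fun x => congrArg φ (LinearMap.congr_fun hr x)⟩

theorem res_indecInjective {π σ τ : P} (h : σ ≤ τ) (x : (indecInjective k π).obj σ)
    (hτ : τ ≤ π) : res (indecInjective k π) h x ⟨hτ⟩ = x ⟨h.trans hτ⟩ := rfl

/-- The morphism to `[π]` given by a linear form on the space at `π`. -/
def toIndec (F : Sheaf k P) (π : P) (φ : F.obj π →ₗ[k] k) : F ⟶ indecInjective k π :=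
  mkHom (fun σ => LinearMap.pi fun h => φ ∘ₗ res F h.down) fun σ τ h x => by
    funext hτ
    exact congrArg φ (res_res F h hτ.down x)

theorem toIndec_apply (F : Sheaf k P) (π : P) (φ : F.obj π →ₗ[k] k) {σ : P} (x : F.obj σ)
    (h : σ ≤ π) : comp (toIndec F π φ) σ x ⟨h⟩ = φ (res F h x) := rfl

/-- The linear form at `π` of a morphism to `[π]`. -/
def ofIndec {F : Sheaf k P} {π : P} (η : F ⟶ indecInjective k π) : F.obj π →ₗ[k] k :=
  LinearMap.proj (R := k) (φ := fun _ : PLift (π ≤ π) => k) ⟨le_rfl⟩ ∘ₗ comp η π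

theorem toIndec_ofIndec {F : Sheaf k P} {π : P} (η : F ⟶ indecInjective k π) :
    toIndec F π (ofIndec η) = η := by
  refine hom_ext_comp fun σ x => funext fun h => ?_
  rw [toIndec_apply]
  change comp η π (res F h.down x) ⟨le_rfl⟩ = _
  rw [comp_res, res_indecInjective]

/-- Morphisms `F ⟶ [π]` are linear forms on `F(π)`, and these extend along injections. -/
instance injective_indecInjective (π : P) : Injective (indecInjective k π) where
  factors {X Y} g η hη := by
    obtain ⟨ψ, hψ⟩ := exists_extend_of_injective (comp η π) ((mono_iff_injective η).1 hη π)
      (ofIndec g)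
    refine ⟨toIndec Y π ψ, ?_⟩
    rw [← toIndec_ofIndec g]
    refine hom_ext_comp fun σ x => funext fun h => ?_
    rw [comp_comp_apply, toIndec_apply, toIndec_apply, ← comp_res, hψ]

theorem eq_zero_of_mem_socle_indecInjective {π σ : P} (hσ : σ ≠ π)
    {x : (indecInjective k π).obj σ} (hx : x ∈ socle (indecInjective k π) σ) : x = 0 := by
  funext h
  exact congrFun (hx π (lt_of_le_of_ne h.down hσ)) ⟨le_rfl⟩

theorem socle_indecInjective_self (π : P) : socle (indecInjective k π) π = ⊤ := by
  refine eq_top_iff.2 fun x _ τ hτ => funext fun h => ?_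
  exact absurd h.down hτ.not_ge

open Classical in
theorem finrank_socle_indecInjective (π σ : P) :
    Module.finrank k (socle (indecInjective k π) σ) = if σ = π then 1 else 0 := by
  split_ifs with h
  · subst h
    rw [socle_indecInjective_self, finrank_top]
    change Module.finrank k (PLift (σ ≤ σ) → k) = 1
    let : Unique (PLift (σ ≤ σ)) := ⟨⟨⟨le_rfl⟩⟩, fun _ => Subsingleton.elim _ _⟩
    rw [Module.finrank_pi, Fintype.card_unique]
  · have : Subsingleton (socle (indecInjective k π) σ) := subsingleton_of_forall_eq 0 fun x =>
      Subtype.ext (eq_zero_of_mem_socle_indecInjective h x.2)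
    exact Module.finrank_zero_of_subsingleton

/-- The socle of a finite direct sum. -/
def socleBiproductEquiv {n : ℕ} (F : Fin n → Sheaf k P) (σ : P) :
    socle (⨁ F) σ ≃ₗ[k] ∀ j, socle (F j) σ where
  toFun x j := socleMap (biproduct.π F j) σ x
  map_add' x y := by ext; simp
  map_smul' c x := by ext; simp
  invFun y := ∑ j, socleMap (biproduct.ι F j) σ (y j)
  left_inv x := by
    refine Subtype.ext ?_
    rw [← comp_id_apply (⨁ F) σ x, ← biproduct.total, comp_sum_apply]
    simp
  right_inv y := by
    classical
    funext i
    refine Subtype.ext ?_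
    simp only [map_sum, AddSubmonoidClass.coe_finsetSum, socleMap_coe, ← comp_comp_apply]
    rw [Finset.sum_eq_single i]
    · simp
    · intro j _ hj
      rw [biproduct.ι_π_ne F hj, comp_zero_apply]
    · simp

open Classical in
theorem finrank_socle_biproduct {n : ℕ} (π : Fin n → P) (σ : P) :
    Module.finrank k (socle (⨁ fun j => indecInjective k (π j)) σ) =
      (Finset.univ.filter fun j => σ = π j).card := by
  rw [(socleBiproductEquiv _ σ).finrank_eq, Module.finrank_pi_fintype]
  simp only [finrank_socle_indecInjective, Finset.sum_boole, Nat.cast_id]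

theorem socleRank_biproduct [Finite P] {n : ℕ} (π : Fin n → P) :
    socleRank (⨁ fun j => indecInjective k (π j)) = n := by
  classical
  let := Fintype.ofFinite P
  simp only [socleRank, finrank_socle_biproduct]
  have := Finset.card_eq_sum_card_fiberwise (f := π) (s := Finset.univ) (t := Finset.univ)
    (fun _ _ => Finset.mem_univ _)
  rw [Finset.card_univ, Fintype.card_fin] at this
  refine Eq.trans ?_ this.symm
  refine Finset.sum_congr rfl fun σ _ => congrArg Finset.card ?_
  ext j
  simp [eq_comm]

/-- Each `[π]` has a one-dimensional socle, so the summand count does not depend on the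
decomposition. -/
theorem HasSummandCount.eq_socleRank [Finite P] {I : Sheaf k P} {n : ℕ}
    (h : HasSummandCount I n) : n = socleRank I := by
  obtain ⟨π, ⟨e⟩⟩ := h
  rw [socleRank_eq_of_iso e, socleRank_biproduct]

/-- Every sheaf embeds into a direct sum of indecomposable injective sheaves with a socle of the
same dimension. -/
theorem exists_hull [Finite P] (F : Sheaf k P) :
    ∃ (π : Fin (socleRank F) → P) (η : F ⟶ ⨁ fun j => indecInjective k (π j)), Mono η := by
  let := Fintype.ofFinite P
  have e : (Σ σ, Fin (Module.finrank k (socle F σ))) ≃ Fin (socleRank F) :=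
    Fintype.equivFinOfCardEq (by simp [socleRank])
  -- Coordinates on the socle at `σ` are extended to the whole stalk; each gives a morphism to
  -- `[σ]`, and together they are injective on socles.
  choose ψ hψ using fun σ => exists_extend_of_injective (socle F σ).subtype
    (Submodule.injective_subtype _) (Module.finBasis k (socle F σ)).equivFun.toLinearMap
  refine ⟨fun j => (e.symm j).1, biproduct.lift fun j => toIndec F (e.symm j).1
    (LinearMap.proj (e.symm j).2 ∘ₗ ψ (e.symm j).1), mono_of_socle _ fun σ x hx h0 => ?_⟩
  have h1 : ∀ s : Σ σ, Fin (Module.finrank k (socle F σ)), comp (toIndec F s.1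
      (LinearMap.proj s.2 ∘ₗ ψ s.1)) σ x = 0 := by
    intro s
    obtain ⟨j, rfl⟩ := e.symm.surjective s
    rw [← biproduct.lift_π (fun j => toIndec F (e.symm j).1
      (LinearMap.proj (e.symm j).2 ∘ₗ ψ (e.symm j).1)) j, comp_comp_apply, h0, map_zero]
  have h2 : (Module.finBasis k (socle F σ)).equivFun ⟨x, hx⟩ = 0 := by
    funext i
    have := congrFun (h1 ⟨σ, i⟩) ⟨le_rfl⟩
    rw [toIndec_apply, res_refl] at this
    exact (congrFun (hψ σ ⟨x, hx⟩) i).symm.trans this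
  exact congrArg Subtype.val ((LinearEquiv.map_eq_zero_iff _).1 h2)

/-- Injectivity splits the embedding into the hull, and equality of socle ranks makes it an
isomorphism. -/
theorem hasSummandCount_socleRank [Finite P] (I : Sheaf k P) [Injective I] :
    HasSummandCount I (socleRank I) := by
  obtain ⟨π, η, hη⟩ := exists_hull I
  have : IsIso η := by
    refine isIso_of_retraction η (Injective.factorThru (𝟙 I) η) (fun σ x _ => ?_)
      (socleRank_biproduct π).le
    rw [← comp_comp_apply, Injective.comp_factorThru, comp_id_apply]
  exact ⟨π, ⟨asIso η⟩⟩

end Indecomposable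

/-! ### The Godement sheaf -/

section Godement

variable {k : Type u} [Field k] {P : Type v} [PartialOrder P]

/-- The direct product, over an enumeration `e` of the poset, of the injective sheaves `[e j]`
tensored with `F(e j)`. -/
def godementObj {n : ℕ} (e : Fin n → P) (F : Sheaf k P) : Sheaf k P where
  obj σ := FGModuleCat.of k (∀ j : Fin n, PLift (σ ≤ e j) → F.obj (e j))
  map {_ _} h := FGModuleCat.ofHom (LinearMap.pi fun j => LinearMap.pi fun hτ =>
    LinearMap.proj (R := k) (φ := fun _ => F.obj (e j)) ⟨(leOfHom h).trans hτ.down⟩ ∘ₗ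
      LinearMap.proj j)

/-- The morphism to the Godement sheaf given by linear maps on the stalks. -/
def toGodement {n : ℕ} {e : Fin n → P} {F G : Sheaf k P} (φ : ∀ j, G.obj (e j) →ₗ[k] F.obj (e j)) :
    G ⟶ godementObj e F :=
  mkHom (fun _ => LinearMap.pi fun j => LinearMap.pi fun h => φ j ∘ₗ res G h.down)
    fun _ _ h x => funext fun j => funext fun hτ => congrArg (φ j) (res_res G h hτ.down x)

theorem toGodement_apply {n : ℕ} {e : Fin n → P} {F G : Sheaf k P}
    (φ : ∀ j, G.obj (e j) →ₗ[k] F.obj (e j)) {σ : P} (x : G.obj σ) (j : Fin n)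
    (h : PLift (σ ≤ e j)) : comp (toGodement φ) σ x j h = φ j (res G h.down x) := rfl

/-- The linear map at `e j` of a morphism to the Godement sheaf. -/
def ofGodement {n : ℕ} {e : Fin n → P} {F G : Sheaf k P} (η : G ⟶ godementObj e F) (j : Fin n) :
    G.obj (e j) →ₗ[k] F.obj (e j) :=
  LinearMap.proj (R := k) (φ := fun _ : PLift (e j ≤ e j) => F.obj (e j)) ⟨le_rfl⟩ ∘ₗ
    LinearMap.proj (R := k) (φ := fun i : Fin n => PLift (e j ≤ e i) → F.obj (e i)) j ∘ₗ
      comp η (e j)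

theorem toGodement_ofGodement {n : ℕ} {e : Fin n → P} {F G : Sheaf k P}
    (η : G ⟶ godementObj e F) : toGodement (ofGodement η) = η := by
  refine hom_ext_comp fun σ x => funext fun j => funext fun h => ?_
  rw [toGodement_apply]
  change comp η (e j) (res G h.down x) j ⟨le_rfl⟩ = _
  rw [comp_res]
  rfl

instance injective_godementObj {n : ℕ} (e : Fin n → P) (F : Sheaf k P) :
    Injective (godementObj e F) where
  factors {X Y} g η hη := by
    choose ψ hψ using fun j => exists_extend_of_injective (comp η (e j))
      ((mono_iff_injective η).1 hη (e j)) (ofGodement g j)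
    refine ⟨toGodement ψ, ?_⟩
    rw [← toGodement_ofGodement g]
    refine hom_ext_comp fun σ x => funext fun j => funext fun h => ?_
    rw [comp_comp_apply, toGodement_apply, toGodement_apply, ← comp_res, hψ]

variable (k) in
/-- The Godement functor. -/
def godement {n : ℕ} (e : Fin n → P) : Sheaf k P ⥤ Sheaf k P where
  obj F := godementObj e F
  map {F _} η := mkHom (fun _ => LinearMap.pi fun j => LinearMap.pi fun h => comp η (e j) ∘ₗ
    LinearMap.proj (R := k) (φ := fun _ => F.obj (e j)) h ∘ₗ LinearMap.proj j) fun _ _ _ _ => rfl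

instance {n : ℕ} (e : Fin n → P) : (godement k e).Additive where
  map_add := rfl

instance {n : ℕ} (e : Fin n → P) (F : Sheaf k P) : Injective ((godement k e).obj F) :=
  injective_godementObj e F

variable (k) in
/-- The unit of the Godement functor. -/
def godementUnit {n : ℕ} (e : Fin n → P) : 𝟭 (Sheaf k P) ⟶ godement k e where
  app _ := toGodement fun _ => LinearMap.id
  naturality _ _ η := hom_ext_comp fun _ x => funext fun _ => funext fun h =>
    (comp_res η h.down x).symm

theorem godementUnit_apply {n : ℕ} (e : Fin n → P) (F : Sheaf k P) {σ : P} (x : F.obj σ)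
    (j : Fin n) (h : PLift (σ ≤ e j)) :
    comp ((godementUnit k e).app F) σ x j h = res F h.down x := rfl

theorem mono_godementUnit_app {n : ℕ} (e : Fin n → P) (he : Function.Surjective e)
    (F : Sheaf k P) : Mono ((godementUnit k e).app F) := by
  refine (mono_iff_injective _).2 fun σ => (injective_iff_map_eq_zero _).2 fun x hx => ?_
  obtain ⟨j, rfl⟩ := he σ
  have := congrFun (congrFun hx j) ⟨le_rfl⟩
  rwa [godementUnit_apply, res_refl] at this

/-- At `σ` only the factor with `e j = σ` survives. Hence the cokernel of the unit vanishes at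
maximal elements of the support. -/
theorem godementUnit_app_surjective {n : ℕ} (e : Fin n ≃ P) (F : Sheaf k P) (σ : P)
    (h : ∀ τ, σ < τ → Subsingleton (F.obj τ)) :
    Function.Surjective (comp ((godementUnit k e).app F) σ) := by
  intro y
  obtain ⟨i, rfl⟩ := e.surjective σ
  refine ⟨y i ⟨le_rfl⟩, funext fun j => funext fun hj => ?_⟩
  rw [godementUnit_apply]
  rcases eq_or_ne i j with rfl | hij
  · rw [res_refl]
  · exact (h _ (lt_of_le_of_ne hj.down (e.injective.ne hij))).elim _ _

/-- `I` is a retract of its Godement sheaf, where a family over `τ` lifts to `σ` through extension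
by zero. -/
theorem res_surjective [Finite P] (I : Sheaf k P) [Injective I] {σ τ : P} (h : σ ≤ τ) :
    Function.Surjective (res I h) := by
  classical
  have e := (Finite.equivFin P).symm
  let η : I ⟶ godementObj e I := (godementUnit k e).app I
  have : Mono η := mono_godementUnit_app e e.surjective I
  let θ := Injective.factorThru (𝟙 I) η
  intro y
  let z : (godementObj e I).obj σ := fun j _ =>
    if hj : τ ≤ e j then comp η τ y j ⟨hj⟩ else 0
  refine ⟨comp θ σ z, ?_⟩
  have hz : res (godementObj e I) h z = comp η τ y := by
    funext j hj
    exact dif_pos hj.down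
  refine (comp_res θ h z).symm.trans ((congrArg (comp θ τ) hz).trans ?_)
  rw [← comp_comp_apply, Injective.comp_factorThru, comp_id_apply]

end Godement

/-! ### Derived category: K-injective targets and short exact sequences -/

section DerivedCategory

open DerivedCategory Pretriangulated

variable {C : Type*} [Category* C] [Abelian C] [HasDerivedCategory.{w} C]

/-- Morphisms into a K-injective complex in the derived category are homotopy classes of chain maps.
-/
theorem exists_quasiIso_of_iso_Q {A J : CochainComplex C ℤ} [J.IsKInjective]
    (e : Q.obj A ≅ Q.obj J) : ∃ α : A ⟶ J, QuasiIso α := by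
  obtain ⟨g, hg⟩ := (CochainComplex.IsKInjective.Qh_map_bijective _ J).surjective
    ((quotientCompQhIso C).hom.app A ≫ e.hom ≫ (quotientCompQhIso C).inv.app J)
  obtain ⟨α, rfl⟩ := (HomotopyCategory.quotient _ _).map_surjective g
  refine ⟨α, ?_⟩
  rw [← isIso_Q_map_iff_quasiIso]
  have : Q.map α = e.hom := by
    rw [← cancel_epi ((quotientCompQhIso C).hom.app A), ← quotientCompQhIso_hom_naturality, hg]
    simp
  rw [this]
  infer_instance

theorem exists_homotopyEquiv_of_iso_Q {I J : CochainComplex C ℤ} [I.IsKInjective]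
    [J.IsKInjective] (e : Q.obj I ≅ Q.obj J) : Nonempty (HomotopyEquiv I J) := by
  obtain ⟨α, hα⟩ := exists_quasiIso_of_iso_Q e
  obtain ⟨e, -⟩ := (CochainComplex.IsKInjective.quasiIso_iff α).1 hα
  exact ⟨e⟩

/-- A short exact sequence `0 → A → E → B → 0` and a K-injective complex `J` isomorphic to `B` in
the derived category present `A` as a mapping cocone. -/
theorem exists_iso_mappingCocone {S : ShortComplex (CochainComplex C ℤ)} (hS : S.ShortExact)
    {J : CochainComplex C ℤ} [J.IsKInjective] (e : Q.obj S.X₃ ≅ Q.obj J) :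
    ∃ φ : S.X₂ ⟶ J, Nonempty (Q.obj S.X₁ ≅ Q.obj (CochainComplex.mappingCocone φ)) := by
  obtain ⟨β, hβ⟩ := exists_quasiIso_of_iso_Q e
  refine ⟨S.g ≫ β, ⟨?_⟩⟩
  let e' : Q.obj S.X₃ ≅ Q.obj J := asIso (Q.map β)
  -- The rotated triangles share their first map up to isomorphism, which identifies their third
  -- objects, the shifts by 1 of the two sides.
  refine (shiftFunctor (DerivedCategory C) (1 : ℤ)).preimageIso
    (Triangle.π₃.mapIso (isoTriangleOfIso₁₂ _ _
      (rot_of_distTriang _ (triangleOfSES_distinguished hS))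
      (rot_of_distTriang _ (mappingCocone_triangle_distinguished (S.g ≫ β)))
      (Iso.refl _) e' ?_))
  change Q.map S.g ≫ Q.map β = 𝟙 (Q.obj S.X₂) ≫ Q.map (S.g ≫ β)
  rw [Category.id_comp, Q.map_comp]

/-- If the middle term of a short exact sequence of complexes is acyclic, its outer terms agree up
to a shift in the derived category. -/
theorem iso_shift_of_shortExact {S : ShortComplex (CochainComplex C ℤ)} (hS : S.ShortExact)
    (h : IsZero (Q.obj S.X₂)) : Nonempty (Q.obj S.X₃ ≅ Q.obj (S.X₁⟦(1 : ℤ)⟧)) := by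
  have := (Triangle.isZero₂_iff_isIso₃ _ (triangleOfSES_distinguished hS)).1 h
  exact ⟨@asIso _ _ _ _ _ this ≪≫ (Q.commShiftIso (1 : ℤ)).symm.app S.X₁⟩

theorem nonempty_iso_Q_shift_of_quasiIso {A B : CochainComplex C ℤ} (γ : A ⟶ B) [QuasiIso γ] :
    Nonempty (Q.obj (A⟦(1 : ℤ)⟧) ≅ Q.obj (B⟦(1 : ℤ)⟧)) :=
  ⟨(Q.commShiftIso (1 : ℤ)).app A ≪≫ (shiftFunctor _ (1 : ℤ)).mapIso (asIso (Q.map γ)) ≪≫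
    (Q.commShiftIso (1 : ℤ)).symm.app B⟩

end DerivedCategory

/-! ### Existence of bounded injective resolutions -/

section Resolutions

open DerivedCategory

variable {k : Type u} [Field k] {P : Type v} [PartialOrder P]

theorem IsInjectiveComplex.isKInjective {J : CochainComplex (Sheaf k P) ℤ}
    (hJ : IsInjectiveComplex J) : J.IsKInjective := by
  obtain ⟨N, hN⟩ := hJ.bounded
  have : J.IsStrictlyGE (-N) := by
    rw [CochainComplex.isStrictlyGE_iff]
    exact fun i hi => hN i (lt_abs.2 (Or.inr (by lia)))
  have := hJ.injective
  exact CochainComplex.isKInjective_of_injective J (-N)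

/-- A complex is bounded if only finitely many of its terms are nonzero. -/
def IsBounded (A : CochainComplex (Sheaf k P) ℤ) : Prop :=
  ∃ N : ℕ, ∀ d : ℤ, (N : ℤ) < |d| → IsZero (A.X d)

theorem isInjectiveComplex_mappingCocone {E J : CochainComplex (Sheaf k P) ℤ} (φ : E ⟶ J)
    (hE : IsInjectiveComplex E) (hJ : IsInjectiveComplex J) :
    IsInjectiveComplex (CochainComplex.mappingCocone φ) := by
  have e (d : ℤ) : Nonempty ((CochainComplex.mappingCocone φ).X d ≅
      (E.X (d + -1 + 1) ⊞ J.X (d + -1))) :=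
    ⟨HomologicalComplex.homotopyCofiber.XIsoBiprod φ (d + -1) (d + -1 + 1) rfl⟩
  obtain ⟨N, hN⟩ := hE.bounded
  obtain ⟨M, hM⟩ := hJ.bounded
  have := hE.injective
  have := hJ.injective
  refine ⟨⟨N + M + 1, fun d hd => ?_⟩, fun d => Injective.of_iso (e d).some.symm inferInstance⟩
  refine IsZero.of_iso ?_ (e d).some
  rw [lt_abs] at hd
  exact (biprod_isZero_iff _ _).2 ⟨hN _ (by rw [lt_abs]; lia), hM _ (by rw [lt_abs]; lia)⟩

end Resolutions

section Resolutions

open DerivedCategory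

variable {k : Type u} [Field k] {P : Type v} [PartialOrder P]

attribute [local instance] Abelian.hasFiniteBiproducts

/-- The embedding of a complex into its Godement complex. -/
def toGodementComplex {n : ℕ} (e : Fin n → P) (A : CochainComplex (Sheaf k P) ℤ) :
    A ⟶ ((godement k e).mapHomologicalComplex (ComplexShape.up ℤ)).obj A where
  f d := (godementUnit k e).app (A.X d)
  comm' i j _ := ((godementUnit k e).naturality (A.d i j)).symm

theorem isInjectiveComplex_godement {n : ℕ} (e : Fin n → P) {A : CochainComplex (Sheaf k P) ℤ}
    (hA : IsBounded A) :
    IsInjectiveComplex (((godement k e).mapHomologicalComplex (ComplexShape.up ℤ)).obj A) := by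
  obtain ⟨N, hN⟩ := hA
  exact ⟨⟨N, fun d hd => (godement k e).map_isZero (hN d hd)⟩,
    fun d => injective_godementObj e (A.X d)⟩

theorem exists_injectiveComplex_of_support [Finite P] [HasDerivedCategory.{w} (Sheaf k P)] (n : ℕ)
    (A : CochainComplex (Sheaf k P) ℤ) (hA : IsBounded A)
    (h : ∀ d τ, n ≤ (Set.Iio τ).ncard → Subsingleton ((A.X d).obj τ)) :
    ∃ J, IsInjectiveComplex J ∧ Nonempty (Q.obj A ≅ Q.obj J) := by
  induction n generalizing A with
  | zero =>
    exact ⟨A, ⟨hA, fun d => ((isZero_iff_subsingleton _).2 fun τ => h d τ (Nat.zero_le _)).injective⟩,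
      ⟨Iso.refl _⟩⟩
  | succ n ih =>
    have e := (Finite.equivFin P).symm
    let ι := toGodementComplex e A
    have hι : Mono ι := by
      have : ∀ d, Mono (ι.f d) := fun d => mono_godementUnit_app e e.surjective (A.X d)
      exact HomologicalComplex.mono_of_mono_f ι this
    let S := ShortComplex.mk ι (cokernel.π ι) (cokernel.condition ι)
    have hS : S.ShortExact :=
      { exact := ShortComplex.exact_cokernel ι
        mono_f := hι
        epi_g := inferInstanceAs (Epi (cokernel.π ι)) }
    have hπ : ∀ d, Epi ((cokernel.π ι).f d) := fun d => inferInstance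
    have hE := isInjectiveComplex_godement e hA
    obtain ⟨J, hJ, ⟨i⟩⟩ := ih (cokernel ι)
      -- If `τ` has at least `n` elements below it, any `ρ > τ` has at least `n + 1`, so `A`
      -- vanishes above `τ` and the unit is onto at `τ`.
      (hE.bounded.imp fun N hN d hd => (hN d hd).of_epi ((cokernel.π ι).f d)) (by
        refine fun d τ hτ => subsingleton_of_forall_eq 0 fun y => ?_
        obtain ⟨z, rfl⟩ := (epi_iff_surjective _).1 (hπ d) τ y
        obtain ⟨x, rfl⟩ := godementUnit_app_surjective e (A.X d) τ (fun ρ hρ => h d ρ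
          (hτ.trans_lt (Set.ncard_lt_ncard (Set.Iio_ssubset_Iio hρ)))) z
        have := congrArg (fun η => comp (η.f d) τ x) (cokernel.condition ι)
        exact this)
    have := hJ.isKInjective
    obtain ⟨φ, hφ⟩ := exists_iso_mappingCocone hS i
    refine ⟨_, ?_, hφ⟩
    have := isInjectiveComplex_mappingCocone φ hE hJ
    exact this

/-- Every bounded complex of sheaves on a finite poset is isomorphic in the derived category to a
bounded complex of injective sheaves. -/
theorem exists_injectiveComplex [Finite P] [HasDerivedCategory.{w} (Sheaf k P)]
    (A : CochainComplex (Sheaf k P) ℤ) (hA : IsBounded A) :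
    ∃ J, IsInjectiveComplex J ∧ Nonempty (Q.obj A ≅ Q.obj J) :=
  exists_injectiveComplex_of_support (Nat.card P + 1) A hA fun _ τ h =>
    absurd (Set.ncard_le_card (Set.Iio τ)) (by lia)

/-- Some summand `[π j]` of `I` already detects `x`. A nonzero socle component at `σ` forces `π j =
σ`, and a nonzero endomorphism of `[σ]` is invertible. -/
theorem exists_section_of_socle [Finite P] {I : Sheaf k P} [Injective I] {σ : P}
    (η : I ⟶ indecInjective k σ) {x : I.obj σ} (hx : x ∈ socle I σ) (h : comp η σ x ≠ 0) :
    ∃ θ : indecInjective k σ ⟶ I, IsIso (θ ≫ η) := by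
  obtain ⟨π, ⟨e⟩⟩ := hasSummandCount_socleRank I
  have hsum : comp η σ x = ∑ j, comp (biproduct.ι _ j ≫ e.inv ≫ η) σ
      (comp (e.hom ≫ biproduct.π _ j) σ x) := by
    simp only [← comp_comp_apply, ← comp_sum_apply]
    congr 2
    simp only [Category.assoc]
    rw [← Preadditive.comp_sum]
    simp only [← Category.assoc]
    rw [← Preadditive.sum_comp, ← Preadditive.sum_comp, biproduct.total]
    simp
  rw [hsum] at h
  obtain ⟨j, -, hj⟩ := Finset.exists_ne_zero_of_sum_ne_zero h
  have hs := comp_mem_socle (e.hom ≫ biproduct.π _ j) hx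
  generalize comp (e.hom ≫ biproduct.π _ j) σ x = y at hj hs
  obtain rfl : σ = π j := by
    by_contra hne
    exact hj (by rw [eq_zero_of_mem_socle_indecInjective hne hs, map_zero])
  refine ⟨biproduct.ι (fun j => indecInjective k (π j)) j ≫ e.inv, ?_⟩
  rw [Category.assoc]
  generalize biproduct.ι (fun j => indecInjective k (π j)) j ≫ e.inv ≫ η = ζ at hj
  have : Mono ζ := by
    refine mono_of_socle ζ fun τ z hz h0 => ?_
    by_cases hτ : τ = π j
    · subst hτ
      have hy : y ⟨le_rfl⟩ ≠ 0 := fun hy => hj (by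
        rw [show y = 0 from funext fun _ => hy, map_zero])
      have hzy : z = (z ⟨le_rfl⟩ / y ⟨le_rfl⟩ : k) • y :=
        funext fun _ => (div_mul_cancel₀ _ hy).symm
      rw [hzy, map_smul] at h0
      rw [hzy, (smul_eq_zero.1 h0).resolve_right hj, zero_smul]
    · exact eq_zero_of_mem_socle_indecInjective hτ hz
  exact isIso_of_mono_of_mono ζ (𝟙 _)

end Resolutions

/-- A contractible summand `X → X` in degrees `d` and `d + 1` of a complex can be removed without
changing the homotopy type. -/
theorem exists_retract_of_section {C : Type*} [Category* C] [Abelian C] (J : CochainComplex C ℤ)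
    {X : C} (d : ℤ) (g : X ⟶ J.X d) (ρ : J.X (d + 1) ⟶ X) (h : g ≫ J.d d (d + 1) ≫ ρ = 𝟙 X) :
    ∃ (R : CochainComplex C ℤ) (i : R ⟶ J) (e : J ⟶ R), i ≫ e = 𝟙 R ∧
      Nonempty (Homotopy (e ≫ i) (𝟙 J)) ∧ g ≫ e.f d = 0 := by
  -- The homotopy is `ρ ≫ g` from degree `d + 1` to `d` and zero elsewhere; its null-homotopic map
  -- `θ` projects onto the contractible summand.
  let s (a b : ℤ) (_ : (ComplexShape.up ℤ).Rel b a) : J.X a ⟶ J.X b :=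
    if hab : a = d + 1 ∧ b = d then
      eqToHom (by rw [hab.1]) ≫ ρ ≫ g ≫ eqToHom (by rw [hab.2])
    else 0
  let θ : J ⟶ J := Homotopy.nullHomotopicMap' s
  have hθ (a b c : ℤ) (hab : a + 1 = b) (hbc : b + 1 = c) :
      θ.f b = J.d b c ≫ s c b hbc + s b a hab ≫ J.d a b :=
    Homotopy.nullHomotopicMap'_f (c := ComplexShape.up ℤ) hab hbc s
  have hs : s (d + 1) d rfl = ρ ≫ g := by simp [s]
  have hs0 (a b : ℤ) (hab : b + 1 = a) (hb : b ≠ d) : s a b hab = 0 :=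
    dif_neg fun h => hb h.2
  have hθd : θ.f d = J.d d (d + 1) ≫ ρ ≫ g := by
    rw [hθ (d - 1) d (d + 1) (sub_add_cancel d 1) rfl, hs,
      hs0 d (d - 1) (sub_add_cancel d 1) (sub_one_lt d).ne]
    simp
  have hθd' : θ.f (d + 1) = ρ ≫ g ≫ J.d d (d + 1) := by
    rw [hθ d (d + 1) (d + 1 + 1) rfl rfl, hs, hs0 (d + 1 + 1) (d + 1) rfl (lt_add_one d).ne']
    simp
  have hidem : θ ≫ θ = θ := by
    ext b
    rw [HomologicalComplex.comp_f]
    by_cases hb : b = d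
    · subst hb
      rw [hθd]
      simp only [Category.assoc, reassoc_of% h]
    · by_cases hb' : b = d + 1
      · subst hb'
        rw [hθd']
        simp only [Category.assoc, reassoc_of% h]
      · rw [hθ (b - 1) b (b + 1) (sub_add_cancel b 1) rfl, hs0 (b + 1) b rfl hb,
          hs0 b (b - 1) (sub_add_cancel b 1) fun h => hb' (sub_eq_iff_eq_add.1 h)]
        simp
  -- `R` is the complement of that summand, and `𝟙 J - θ` is homotopic to `𝟙 J`.
  obtain ⟨R, i, e, hie, hei⟩ := IsIdempotentComplete.idempotents_split J (𝟙 J - θ)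
    (by simp [hidem])
  refine ⟨R, i, e, hie, ⟨?_⟩, ?_⟩
  · exact (Homotopy.ofEq hei).trans (Homotopy.equivSubZero.symm
      ((Homotopy.ofEq (sub_sub_cancel _ _)).trans (Homotopy.nullHomotopy' s))).symm
  · have hmono : (e.f d ≫ i.f d) ≫ e.f d = e.f d := by
      rw [Category.assoc, ← HomologicalComplex.comp_f, hie, HomologicalComplex.id_f,
        Category.comp_id]
    rw [← hmono, ← HomologicalComplex.comp_f, hei, HomologicalComplex.sub_f_apply,
      HomologicalComplex.id_f, hθd, Preadditive.sub_comp, Preadditive.comp_sub]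
    simp only [Category.assoc, Category.id_comp, reassoc_of% h, sub_self]

/-! ### Reduction to radical complexes -/

section Radical

open DerivedCategory

variable {k : Type u} [Field k] {P : Type v} [PartialOrder P]

/-- The differential of a radical complex vanishes on all socles. -/
def IsRadical (J : CochainComplex (Sheaf k P) ℤ) : Prop :=
  ∀ (i j : ℤ) (σ : P), ∀ x ∈ socle (J.X i) σ, comp (J.d i j) σ x = 0

theorem exists_section_of_not_isRadical [Finite P] {J : CochainComplex (Sheaf k P) ℤ}
    (hJ : IsInjectiveComplex J) (h : ¬ IsRadical J) :
    ∃ (σ : P) (d : ℤ) (g : indecInjective k σ ⟶ J.X d) (ρ : J.X (d + 1) ⟶ indecInjective k σ),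
      g ≫ J.d d (d + 1) ≫ ρ = 𝟙 _ := by
  simp only [IsRadical, not_forall] at h
  obtain ⟨d, j, σ, x, hx, hne⟩ := h
  obtain rfl : d + 1 = j := by
    by_contra hj
    exact hne (by rw [J.shape d j hj, comp_zero_apply])
  -- `φ` is a linear form taking the value 1 on the differential of `x`.
  obtain ⟨φ, hφ⟩ := exists_extend_of_injective
    (LinearMap.toSpanSingleton k _ (comp (J.d d (d + 1)) σ x))
    (smul_left_injective k hne) (LinearMap.id : k →ₗ[k] k)
  have := hJ.injective
  obtain ⟨θ, hθ⟩ := exists_section_of_socle (J.d d (d + 1) ≫ toIndec _ σ φ) hx (fun h0 => by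
    have h1 := congrFun h0 ⟨le_rfl⟩
    rw [comp_comp_apply, toIndec_apply, res_refl] at h1
    have h2 := hφ 1
    rw [LinearMap.toSpanSingleton_apply, one_smul] at h2
    exact one_ne_zero (h2.symm.trans h1))
  exact ⟨σ, d, θ, toIndec _ σ φ ≫ inv (θ ≫ J.d d (d + 1) ≫ toIndec _ σ φ), by
    simpa only [Category.assoc] using IsIso.hom_inv_id (θ ≫ J.d d (d + 1) ≫ toIndec _ σ φ)⟩

theorem not_isZero_indecInjective (σ : P) : ¬ IsZero (indecInjective k σ) := fun h => by
  have : Subsingleton (PLift (σ ≤ σ) → k) := (isZero_iff_subsingleton _).1 h σ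
  exact one_ne_zero (congrFun (Subsingleton.elim (fun _ : PLift (σ ≤ σ) => (1 : k)) 0) ⟨le_rfl⟩)

/-- The total dimension of the stalks of a complex in the degrees between `-N` and `N`. -/
def totalRank [Finite P] (N : ℕ) (J : CochainComplex (Sheaf k P) ℤ) : ℕ :=
  letI := Fintype.ofFinite P
  ∑ d ∈ Finset.Icc (-N : ℤ) N, ∑ σ, Module.finrank k ((J.X d).obj σ)

theorem totalRank_lt [Finite P] {N : ℕ} {R J : CochainComplex (Sheaf k P) ℤ} (i : R ⟶ J)
    (hi : ∀ d, Mono (i.f d)) {d : ℤ} (hd : |d| ≤ N) (h : ¬ IsIso (i.f d)) :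
    totalRank N R < totalRank N J := by
  let := Fintype.ofFinite P
  have hinj (d : ℤ) (σ : P) := (mono_iff_injective (i.f d)).1 (hi d) σ
  have hle (d : ℤ) (σ : P) :
      Module.finrank k ((R.X d).obj σ) ≤ Module.finrank k ((J.X d).obj σ) :=
    LinearMap.finrank_le_finrank_of_injective (hinj d σ)
  refine Finset.sum_lt_sum (fun d _ => Finset.sum_le_sum fun σ _ => hle d σ)
    ⟨d, Finset.mem_Icc.2 (abs_le.1 hd), Finset.sum_lt_sum (fun σ _ => hle d σ) ?_⟩
  by_contra! hge
  refine h ?_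
  have := hi d
  have : Epi (i.f d) := (epi_iff_surjective _).2 fun σ =>
    (LinearMap.injective_iff_surjective_of_finrank_eq_finrank
      (le_antisymm (hle d σ) (hge σ (Finset.mem_univ σ)))).1 (hinj d σ)
  exact isIso_of_mono_of_epi _

/-- Every bounded complex of injective sheaves is homotopy equivalent to a radical one. -/
theorem exists_radical [Finite P] [HasDerivedCategory.{w} (Sheaf k P)]
    (J : CochainComplex (Sheaf k P) ℤ) (hJ : IsInjectiveComplex J) :
    ∃ R, IsInjectiveComplex R ∧ IsRadical R ∧ Nonempty (Q.obj J ≅ Q.obj R) := by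
  obtain ⟨N, hN⟩ := hJ.bounded
  -- `N` stays fixed: a retract of `J` vanishes wherever `J` does.
  induction hn : totalRank N J using Nat.strong_induction_on generalizing J with
  | _ n ih =>
    by_cases hrad : IsRadical J
    · exact ⟨J, hJ, hrad, ⟨Iso.refl _⟩⟩
    obtain ⟨σ, d, g, ρ, h⟩ := exists_section_of_not_isRadical hJ hrad
    obtain ⟨R, i, e, hie, ⟨hei⟩, hge⟩ := exists_retract_of_section J d g ρ h
    have hie' (d : ℤ) : i.f d ≫ e.f d = 𝟙 _ := by
      rw [← HomologicalComplex.comp_f, hie, HomologicalComplex.id_f]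
    have hmono (d : ℤ) : Mono (i.f d) := SplitMono.mono ⟨e.f d, hie' d⟩
    have hg : ¬ IsZero (J.X d) := fun h0 => not_isZero_indecInjective (k := k) σ
      ((IsZero.iff_id_eq_zero _).2 (by rw [← h, h0.eq_of_tgt g 0, zero_comp]))
    have hR0 (d : ℤ) (hd : (N : ℤ) < |d|) : IsZero (R.X d) := (hN d hd).of_mono (i.f d)
    have hRinj (d : ℤ) : Injective (R.X d) := by
      have := hJ.injective d
      exact Retract.injective ⟨i.f d, e.f d, hie' d⟩
    obtain ⟨R', hR', hrad', ⟨f⟩⟩ := ih _ (hn ▸ totalRank_lt i hmono (d := d)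
      -- Were `i.f d` invertible, so would be `e.f d`; then `g ≫ e.f d = 0` would give `g = 0`.
      (not_lt.1 fun hd => hg (hN d hd)) (fun hiso => by
        have : IsIso (e.f d) := by
          rw [IsIso.eq_inv_of_hom_inv_id (hie' d)]
          infer_instance
        refine not_isZero_indecInjective (k := k) σ ((IsZero.iff_id_eq_zero _).2 ?_)
        rw [← h, (cancel_mono (e.f d)).1 (hge.trans zero_comp.symm), zero_comp]))
      R ⟨⟨N, hR0⟩, hRinj⟩ hR0 rfl
    refine ⟨R', hR', hrad', ⟨(⟨Q.map e, Q.map i, ?_, ?_⟩ : Q.obj J ≅ Q.obj R) ≪≫ f⟩⟩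
    · rw [← Q.map_comp, Q_map_eq_of_homotopy _ hei, Q.map_id]
    · rw [← Q.map_comp, hie, Q.map_id]

end Radical

/-! ### Radical complexes are minimal; uniqueness -/

section Minimal

open DerivedCategory

variable {k : Type u} [Field k] {P : Type v} [PartialOrder P]

theorem QuasiIsomorphic.nonempty_iso_Q [HasDerivedCategory.{w} (Sheaf k P)]
    {A B : CochainComplex (Sheaf k P) ℤ} (h : QuasiIsomorphic A B) :
    Nonempty (Q.obj A ≅ Q.obj B) := by
  obtain ⟨K, α, β, _, _⟩ := h
  exact ⟨(asIso (Q.map α)).symm ≪≫ asIso (Q.map β)⟩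

theorem quasiIsomorphic_of_homotopyEquiv {A B : CochainComplex (Sheaf k P) ℤ}
    (e : HomotopyEquiv A B) : QuasiIsomorphic A B :=
  ⟨A, 𝟙 A, e.hom, inferInstance, e.quasiIso_hom⟩

/-- Both homotopy terms vanish on socles: the homotopy maps socles to socles, and the differential
of `R` kills them. -/
theorem IsRadical.inv_hom_apply {R J : CochainComplex (Sheaf k P) ℤ} (hR : IsRadical R)
    (e : HomotopyEquiv R J) (d : ℤ) (σ : P) (x : (R.X d).obj σ) (hx : x ∈ socle (R.X d) σ) :
    comp (e.inv.f d) σ (comp (e.hom.f d) σ x) = x := by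
  have h := e.homotopyHomInvId.comm d
  rw [dNext_eq _ (show (ComplexShape.up ℤ).Rel d (d + 1) from rfl),
    prevD_eq _ (show (ComplexShape.up ℤ).Rel (d - 1) d from sub_add_cancel d 1)] at h
  rw [← comp_comp_apply, ← HomologicalComplex.comp_f, h]
  simp only [comp_add_apply, comp_comp_apply]
  rw [hR d (d + 1) σ x hx, map_zero, hR _ _ σ _ (comp_mem_socle _ hx), zero_add, zero_add]
  rfl

theorem IsRadical.mono_hom_f [Finite P] {R J : CochainComplex (Sheaf k P) ℤ} (hR : IsRadical R)
    (e : HomotopyEquiv R J) (d : ℤ) : Mono (e.hom.f d) :=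
  mono_of_socle _ fun σ x hx h0 => by rw [← hR.inv_hom_apply e d σ x hx, h0, map_zero]

theorem IsRadical.isMinimalInjectiveComplex [Finite P] {R : CochainComplex (Sheaf k P) ℤ}
    (hR : IsRadical R) (hinj : IsInjectiveComplex R) : IsMinimalInjectiveComplex R where
  toIsInjectiveComplex := hinj
  minimal J hJ hRJ d n m hn hm := by
    let := HasDerivedCategory.standard (Sheaf k P)
    have := hinj.isKInjective
    have := hJ.isKInjective
    obtain ⟨i⟩ := hRJ.nonempty_iso_Q
    obtain ⟨e⟩ := exists_homotopyEquiv_of_iso_Q i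
    have := hR.mono_hom_f e d
    rw [hn.eq_socleRank, hm.eq_socleRank]
    exact socleRank_le_of_mono (e.hom.f d)

/-- Minimality of `J` bounds its socle ranks by those of `R`, so the degreewise retraction on socles
becomes an isomorphism. -/
theorem IsRadical.nonempty_iso [Finite P] [HasDerivedCategory.{w} (Sheaf k P)]
    {R J : CochainComplex (Sheaf k P) ℤ} (hR : IsRadical R) (hinj : IsInjectiveComplex R)
    (hJ : IsMinimalInjectiveComplex J) (i : Q.obj R ≅ Q.obj J) : Nonempty (R ≅ J) := by
  have := hinj.isKInjective
  have := hJ.toIsInjectiveComplex.isKInjective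
  obtain ⟨e⟩ := exists_homotopyEquiv_of_iso_Q i
  have (d : ℤ) : IsIso (e.hom.f d) := by
    have := hinj.injective d
    have := hJ.injective d
    exact isIso_of_retraction (e.hom.f d) (e.inv.f d) (hR.inv_hom_apply e d)
      (hJ.minimal R hinj (quasiIsomorphic_of_homotopyEquiv e.symm) d _ _
        (hasSummandCount_socleRank _) (hasSummandCount_socleRank _))
  have : IsIso e.hom := HomologicalComplex.Hom.isIso_of_components e.hom
  exact ⟨asIso e.hom⟩

theorem exists_isMinimalInjectiveResolution [Finite P] (A : CochainComplex (Sheaf k P) ℤ)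
    (hA : IsBounded A) : ∃ J, IsMinimalInjectiveResolution A J := by
  let := HasDerivedCategory.standard (Sheaf k P)
  obtain ⟨J, hJ, ⟨i⟩⟩ := exists_injectiveComplex A hA
  obtain ⟨R, hR, hrad, ⟨j⟩⟩ := exists_radical J hJ
  have := hR.isKInjective
  exact ⟨R, hrad.isMinimalInjectiveComplex hR, exists_quasiIso_of_iso_Q (i ≪≫ j)⟩

theorem exists_isRightDerived {L : Type*} [PartialOrder L] [Finite P] (F : Sheaf k L ⥤ Sheaf k P)
    [F.Additive] {I : CochainComplex (Sheaf k L) ℤ} (hI : IsInjectiveComplex I) :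
    ∃ J, IsRightDerived F I J :=
  exists_isMinimalInjectiveResolution _
    (hI.bounded.imp fun _ hN d hd => F.map_isZero (hN d hd))

theorem IsInjectiveComplex.shift {J : CochainComplex (Sheaf k P) ℤ} (hJ : IsInjectiveComplex J) :
    IsInjectiveComplex (J⟦(1 : ℤ)⟧) := by
  obtain ⟨N, hN⟩ := hJ.bounded
  refine ⟨⟨N + 1, fun d hd => hN (d + 1) ?_⟩, fun d => hJ.injective (d + 1)⟩
  rw [lt_abs] at hd ⊢
  lia

theorem IsRadical.shift {J : CochainComplex (Sheaf k P) ℤ} (hJ : IsRadical J) :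
    IsRadical (J⟦(1 : ℤ)⟧) := by
  intro i j σ x hx
  rw [CochainComplex.shiftFunctor_obj_d', Int.negOnePow_one, Units.neg_smul, one_smul]
  exact neg_eq_zero.2 (hJ (i + 1) (j + 1) σ x hx)

/-- Minimal injective complexes which are isomorphic in the derived category up to a shift are
isomorphic up to that shift. -/
theorem IsMinimalInjectiveComplex.nonempty_iso_shift [Finite P]
    [HasDerivedCategory.{w} (Sheaf k P)] {A C : CochainComplex (Sheaf k P) ℤ}
    (hA : IsMinimalInjectiveComplex A) (hC : IsMinimalInjectiveComplex C)
    (i : Q.obj A ≅ Q.obj (C⟦(1 : ℤ)⟧)) : Nonempty (A ≅ C⟦(1 : ℤ)⟧) := by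
  -- Passing to a radical model of `C` helps because being radical is visibly stable under shift.
  obtain ⟨R, hR, hrad, ⟨j⟩⟩ := exists_radical C hC.toIsInjectiveComplex
  obtain ⟨e⟩ := hrad.nonempty_iso hR hC j.symm
  obtain ⟨e'⟩ := hrad.shift.nonempty_iso hR.shift hA
    (Q.mapIso ((shiftFunctor _ (1 : ℤ)).mapIso e) ≪≫ i.symm)
  exact ⟨e'.symm ≪≫ (shiftFunctor _ (1 : ℤ)).mapIso e⟩

end Minimal

/-! ### Exactness of pullback, and `e^* e_! = id` -/

section Pullback

variable (k : Type u) [Field k]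
variable {P : Type v} {L : Type w} [PartialOrder P] [PartialOrder L]

instance (f : P →o L) : PreservesFiniteLimits (pullback k f) :=
  ⟨fun _ _ _ => by unfold pullback; infer_instance⟩

instance (f : P →o L) : PreservesFiniteColimits (pullback k f) :=
  ⟨fun _ _ _ => by unfold pullback; infer_instance⟩

/-- The unit `F → e^* e_! F` of an embedding `e`. -/
def pullbackProperPushforwardUnit (e : P ↪o L) (he : IsLocallyClosed (Set.range e)) :
    𝟭 (Sheaf k P) ⟶ properPushforward k e he ⋙ pullback k e.toOrderHom where
  app F := mkHom (fun σ => LinearMap.pi fun h =>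
      res F (e.le_iff_le.1 (apply_preimage h.down).ge)) fun σ τ h x => by
    funext hτ
    refine Eq.trans ?_ (extByZeroMap_apply_of_mem e F (e.monotone h) ⟨σ, rfl⟩ _ hτ).symm
    exact (res_res F _ _ x).trans (res_res F _ _ x).symm
  naturality F G η := hom_ext_comp fun σ x => funext fun h => (comp_res η _ x).symm

instance (e : P ↪o L) (he : IsLocallyClosed (Set.range e)) (F : Sheaf k P) :
    IsIso ((pullbackProperPushforwardUnit k e he).app F) := by
  have hle (σ : P) (h : PLift (e σ ∈ Set.range e)) : σ ≤ preimage h.down :=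
    e.le_iff_le.1 (apply_preimage h.down).ge
  have hge (σ : P) (h : PLift (e σ ∈ Set.range e)) : preimage h.down ≤ σ :=
    e.le_iff_le.1 (apply_preimage h.down).le
  have : Mono ((pullbackProperPushforwardUnit k e he).app F) := by
    refine (mono_iff_injective _).2 fun σ => (injective_iff_map_eq_zero _).2 fun x hx => ?_
    have h1 : res F (hle σ ⟨⟨σ, rfl⟩⟩) x = 0 := congrFun hx ⟨⟨σ, rfl⟩⟩
    rw [← res_refl F σ x, ← res_res F (hle σ ⟨⟨σ, rfl⟩⟩) (hge σ ⟨⟨σ, rfl⟩⟩), h1, map_zero]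
  have : Epi ((pullbackProperPushforwardUnit k e he).app F) := by
    refine (epi_iff_surjective _).2 fun σ y => ⟨res F (hge σ ⟨⟨σ, rfl⟩⟩) (y ⟨⟨σ, rfl⟩⟩), ?_⟩
    funext h
    exact (res_res F _ (hle σ h) _).trans (res_refl F _ _)
  exact isIso_of_mono_of_epi _

theorem properPushforward_obj_subsingleton (e : P ↪o L) (he : IsLocallyClosed (Set.range e))
    (F : Sheaf k P) {σ : L} (hσ : σ ∉ Set.range e) :
    Subsingleton (((properPushforward k e he).obj F).obj σ) :=
  ⟨fun _ _ => funext fun h => absurd h.down hσ⟩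

end Pullback

/-! ### The short exact sequence on the mapping cylinder -/

namespace MappingCylinder

variable (k : Type u) [Field k]
variable {P : Type v} {L : Type w} [PartialOrder P] [PartialOrder L] (f : P →o L)

/-- The pullback to the source of the mapping cylinder. -/
abbrev toSource : Sheaf k (MappingCylinder f) ⥤ Sheaf k P :=
  pullback k (inclSource f).toOrderHom

/-- The pullback to the target of the mapping cylinder. -/
abbrev toTarget : Sheaf k (MappingCylinder f) ⥤ Sheaf k L :=
  pullback k (inclTarget f).toOrderHom

theorem inclSource_le_inclTarget (π : P) : inclSource f π ≤ inclTarget f (f π) :=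
  le_refl (f π)

/-- The inclusion `p^! → p^*`. -/
def sourceInclusion : properPullback k (inclSource f) ⟶ toSource k f where
  app F := mkHom (fun σ => (properSections (inclSource f) F σ).subtype) fun _ _ _ _ => rfl

/-- The structure maps of a sheaf on the mapping cylinder from the source to the target. -/
def sourceToTarget : toSource k f ⟶ toTarget k f ⋙ pullback k f where
  app F := mkHom (fun σ => res F (inclSource_le_inclTarget f σ)) fun _ _ _ x =>
    (res_res F _ _ x).trans (res_res F _ _ x).symm
  naturality _ _ η := hom_ext_comp fun _ x => (comp_res η _ x).symm

theorem finite [Finite P] [Finite L] : Finite (MappingCylinder f) :=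
  Finite.of_surjective (fun x : P ⊕ L => x.elim (inclSource f) (inclTarget f)) (by
    rintro (p | l)
    · exact ⟨Sum.inl p, rfl⟩
    · exact ⟨Sum.inr l, rfl⟩)

variable {k f}

theorem mem_properSections_iff {F : Sheaf k (MappingCylinder f)} {π : P}
    (x : F.obj (inclSource f π)) : x ∈ properSections (inclSource f) F π ↔
      res F (inclSource_le_inclTarget f π) x = 0 := by
  constructor
  · refine fun hx => hx _ (inclSource_le_inclTarget f π) ?_
    rintro ⟨q, hq⟩
    cases hq
  · rintro hx (q | l) h hτ
    · exact absurd ⟨q, rfl⟩ hτ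
    · have hl : inclTarget f (f π) ≤ inclTarget f l := h
      exact (res_res F (inclSource_le_inclTarget f π) hl x).symm.trans (by rw [hx, map_zero]; rfl)

theorem sourceInclusion_sourceToTarget (F : Sheaf k (MappingCylinder f)) :
    (sourceInclusion k f).app F ≫ (sourceToTarget k f).app F = 0 :=
  hom_ext_comp fun _ x => (mem_properSections_iff _).1 x.2

/-- Injectivity of `F` is used only for surjectivity on the right; the kernel is `p^! F` for every
sheaf. -/
theorem shortExact_of_injective [Finite P] [Finite L] (F : Sheaf k (MappingCylinder f))
    [Injective F] : (ShortComplex.mk _ _ (sourceInclusion_sourceToTarget F)).ShortExact := by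
  have := MappingCylinder.finite f
  have hmono : Mono ((sourceInclusion k f).app F) :=
    (mono_iff_injective _).2 fun σ => Subtype.val_injective
  have hepi : Epi ((sourceToTarget k f).app F) :=
    (epi_iff_surjective _).2 fun σ => res_surjective F (inclSource_le_inclTarget f σ)
  refine { exact := ShortComplex.exact_of_f_is_kernel _ ?_, mono_f := hmono, epi_g := hepi }
  refine KernelFork.IsLimit.ofι' _ _ fun {W} g hg => ⟨mkHom (fun σ => (comp g σ).codRestrict
    (properSections (inclSource f) F σ) fun x => (mem_properSections_iff _).2 ?_) ?_, ?_⟩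
  · exact congrArg (fun η => comp η σ x) hg
  · exact fun σ τ h x => Subtype.ext (comp_res g h x)
  · rfl

open DerivedCategory in
/-- For a complex of injective sheaves on the mapping cylinder with acyclic restriction to the
source, pulling back to the target and then along `f` agrees with `p^!` up to a shift. -/
theorem nonempty_iso_Q_shift [Finite P] [Finite L] [HasDerivedCategory.{w₁} (Sheaf k P)]
    {B : CochainComplex (Sheaf k (MappingCylinder f)) ℤ} (hB : IsInjectiveComplex B)
    (h : IsZero (Q.obj (((toSource k f).mapHomologicalComplex (ComplexShape.up ℤ)).obj B))) :
    Nonempty (Q.obj (((toTarget k f ⋙ pullback k f).mapHomologicalComplex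
        (ComplexShape.up ℤ)).obj B) ≅
      Q.obj ((((properPullback k (inclSource f)).mapHomologicalComplex
        (ComplexShape.up ℤ)).obj B)⟦(1 : ℤ)⟧)) := by
  let S : ShortComplex (CochainComplex (Sheaf k P) ℤ) :=
    ShortComplex.mk ((NatTrans.mapHomologicalComplex (sourceInclusion k f) _).app B)
      ((NatTrans.mapHomologicalComplex (sourceToTarget k f) _).app B)
      (HomologicalComplex.hom_ext _ _ fun d => sourceInclusion_sourceToTarget (B.X d))
  have hS : S.ShortExact := HomologicalComplex.shortExact_of_degreewise_shortExact _ fun d => by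
    have := hB.injective d
    exact shortExact_of_injective (B.X d)
  exact iso_shift_of_shortExact hS h

end MappingCylinder

/-! ### Restricting a resolution of `ℓ_! I` to the source and the target -/

namespace MappingCylinder

open DerivedCategory

variable {k : Type u} [Field k]
variable {P : Type v} {L : Type w} [PartialOrder P] [PartialOrder L] {f : P →o L}

theorem isZero_toSource_obj_properPushforward (F : Sheaf k L) :
    IsZero ((toSource k f).obj ((properPushforward k (inclTarget f)
      (isLocallyClosed_target f)).obj F)) :=
  (isZero_iff_subsingleton _).2 fun σ =>
    properPushforward_obj_subsingleton k _ (isLocallyClosed_target f) F (σ := inclSource f σ) (by rintro ⟨l, hl⟩; cases hl)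

variable [HasDerivedCategory.{w₁} (Sheaf k P)] {I : CochainComplex (Sheaf k L) ℤ}
  {B : CochainComplex (Sheaf k (MappingCylinder f)) ℤ}

theorem isZero_Q_toSource (α : ((properPushforward k (inclTarget f)
      (isLocallyClosed_target f)).mapHomologicalComplex (ComplexShape.up ℤ)).obj I ⟶ B)
    [QuasiIso α] :
    IsZero (Q.obj (((toSource k f).mapHomologicalComplex (ComplexShape.up ℤ)).obj B)) := by
  refine IsZero.of_iso ?_ (asIso (Q.map
    (((toSource k f).mapHomologicalComplex (ComplexShape.up ℤ)).map α))).symm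
  refine Q.map_isZero ((IsZero.iff_id_eq_zero _).2 ?_)
  ext d : 1
  exact (isZero_toSource_obj_properPushforward (I.X d)).eq_of_src _ _

theorem nonempty_iso_Q_toTarget (α : ((properPushforward k (inclTarget f)
      (isLocallyClosed_target f)).mapHomologicalComplex (ComplexShape.up ℤ)).obj I ⟶ B)
    [QuasiIso α] :
    Nonempty (Q.obj (((pullback k f).mapHomologicalComplex (ComplexShape.up ℤ)).obj I) ≅
      Q.obj (((toTarget k f ⋙ pullback k f).mapHomologicalComplex
        (ComplexShape.up ℤ)).obj B)) := by
  let β : I ⟶ ((toTarget k f).mapHomologicalComplex (ComplexShape.up ℤ)).obj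
      (((properPushforward k (inclTarget f)
        (isLocallyClosed_target f)).mapHomologicalComplex (ComplexShape.up ℤ)).obj I) :=
    (NatTrans.mapHomologicalComplex (pullbackProperPushforwardUnit k (inclTarget f)
      (isLocallyClosed_target f)) (ComplexShape.up ℤ)).app I
  have hβ (d : ℤ) : IsIso (β.f d) := inferInstanceAs (IsIso
    ((pullbackProperPushforwardUnit k (inclTarget f) (isLocallyClosed_target f)).app (I.X d)))
  have : IsIso β := HomologicalComplex.Hom.isIso_of_components β
  let γ := β ≫ ((toTarget k f).mapHomologicalComplex (ComplexShape.up ℤ)).map α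
  have : QuasiIso γ := inferInstance
  let δ := ((pullback k f).mapHomologicalComplex (ComplexShape.up ℤ)).map γ
  have : QuasiIso δ := inferInstance
  let i := asIso (Q.map δ)
  exact ⟨i⟩

end MappingCylinder

end PosetSheaf

end

theorem mainTheorem12 (k : Type u) [Field k]
    (P : Type v) [PartialOrder P] [Finite P] (L : Type w) [PartialOrder L] [Finite L]
    (f : P →o L)
    (I : CochainComplex (PosetSheaf.Sheaf k L) ℤ) (hI : PosetSheaf.IsInjectiveComplex I) :
    -- `Rf^* I`, `Rℓ_! I` and `Rp^! Rℓ_! I` exist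
    (∃ A, PosetSheaf.IsRightDerived (PosetSheaf.pullback k f) I A) ∧
    (∃ B, PosetSheaf.IsRightDerived
      (PosetSheaf.properPushforward k (PosetSheaf.MappingCylinder.inclTarget f)
        (PosetSheaf.MappingCylinder.isLocallyClosed_target f)) I B) ∧
    (∀ B, PosetSheaf.IsRightDerived
      (PosetSheaf.properPushforward k (PosetSheaf.MappingCylinder.inclTarget f)
        (PosetSheaf.MappingCylinder.isLocallyClosed_target f)) I B →
      ∃ C, PosetSheaf.IsRightDerived
        (PosetSheaf.properPullback k (PosetSheaf.MappingCylinder.inclSource f)) B C) ∧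
    -- and `Rf^* I = (Rp^! Rℓ_! I)[1]`, as an isomorphism of (minimal) complexes
    (∀ A B C, PosetSheaf.IsRightDerived (PosetSheaf.pullback k f) I A →
      PosetSheaf.IsRightDerived
        (PosetSheaf.properPushforward k (PosetSheaf.MappingCylinder.inclTarget f)
          (PosetSheaf.MappingCylinder.isLocallyClosed_target f)) I B →
      PosetSheaf.IsRightDerived
        (PosetSheaf.properPullback k (PosetSheaf.MappingCylinder.inclSource f)) B C →
      Nonempty (A ≅ C⟦(1 : ℤ)⟧)) := by
  refine ⟨PosetSheaf.exists_isRightDerived _ hI, ?_, fun B hB =>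
    PosetSheaf.exists_isRightDerived _ hB.1.toIsInjectiveComplex, ?_⟩
  · have : Finite (PosetSheaf.MappingCylinder f) := PosetSheaf.MappingCylinder.finite f
    exact PosetSheaf.exists_isRightDerived _ hI
  · rintro A B C ⟨hA, α, hα⟩ ⟨hB, β, hβ⟩ ⟨hC, γ, hγ⟩
    let := HasDerivedCategory.standard (PosetSheaf.Sheaf k P)
    obtain ⟨i⟩ := PosetSheaf.MappingCylinder.nonempty_iso_Q_toTarget β
    obtain ⟨j⟩ := PosetSheaf.MappingCylinder.nonempty_iso_Q_shift hB.toIsInjectiveComplex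
      (PosetSheaf.MappingCylinder.isZero_Q_toSource β)
    obtain ⟨l⟩ := PosetSheaf.nonempty_iso_Q_shift_of_quasiIso γ
    -- The chain is `A ≅ f^* I ≅ f^* ℓ^* B ≅ (p^! B)[1] ≅ C[1]`.
    exact hA.nonempty_iso_shift hC ((asIso (DerivedCategory.Q.map α)).symm ≪≫ i ≪≫ j ≪≫ l)
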